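/- Let $\mathcal X$ be a complete separable metric space and $\mathcal Y\subset\mathbb R$ a closed set, both with their Borel $\sigma$-algebras, and let $\mathcal M_1(\mathcal X\times\mathcal Y)$ denote the set of Borel probability measures on $\mathcal X\times\mathcal Y$. Let $k:\mathcal X^2\times\mathcal X^2\to\mathbb R$ be a continuous kernel that is bounded, i.e. $\|k\|_\infty=\sup_{z\in\mathcal X^2}\sqrt{k(z,z)}<\infty$, let $H$ be its (real) reproducing kernel Hilbert space and $\Phi(x,x')=k(\cdot,(x,x'))\in H$ its canonical feature map. Let $L:(\mathcal X\times\mathcal Y)^2\times\mathbb R\to[0,\infty)$ be measurable and such that, in its last (fifth) argument $t$, it is convex, Lipschitz continuous uniformly in $(x,y,x',y')$, and twice continuously differentiable, with first and second derivatives $D_5L$, $D_5D_5L$ in $t$ that are bounded on $(\mathcal X\times\mathcal Y)^2\times\mathbb R$. Let $L^*(x,y,x',y',t)=L(x,y,x',y',t)-L(x,y,x',y',0)$ and $\lambda>0$, and for $P\in\mathcal M_1(\mathcal X\times\mathcal Y)$ and $f\in H$ put $$\mathcal R^{\mathrm{reg}}_{P}(f)=\mathbb E_{P\otimes P}\big[L^*(X,Y,X',Y',f(X,X'))\big]+\lambda\|f\|_H^2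 .$$ Then, for every $P$, the expectation in $\mathcal R^{\mathrm{reg}}_{P}(f)$ is finite for all $f\in H$, and $\mathcal R^{\mathrm{reg}}_{P}$ has exactly one minimizer $f_{L^*,P,\lambda}$ in $H$; so the operator $S:\mathcal M_1(\mathcal X\times\mathcal Y)\to H$, $S(P)=f_{L^*,P,\lambda}$, is well defined. Fix $P$ and write $L'_P(x,y,x',y')=D_5L(x,y,x',y',f_{L^*,P,\lambda}(x,x'))$ and $L''_P(x,y,x',y')=D_5D_5L(x,y,x',y',f_{L^*,P,\lambda}(x,x'))$. For $Q\in\mathcal M_1(\mathcal X\times\mathcal Y)$ let $$T(Q;P)=-2\,\mathbb E_{P\otimes P}[L'_P\,\Phi(X,X')]+\mathbb E_{P\otimes Q}[L'_P\,\Phi(X,X')]+\mathbb E_{Q\otimes P}[L'_P\,\Phi(X,X')]\in H,$$ $$M(P)=2\lambda\,\mathrm{id}_H+\mathbb E_{P\otimes P}\big[L''_P\,\langle\Phi(X,X'),\cdot\rangle_H\,\Phi(X,X')\big]\in\mathcal L(H,H),$$ where the expectations are Bochner integrals; all their integrands, and more generally $L'_P\,\Phi$ and $L''_P\langle\Phi,\cdot\rangle_H\Phi$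 with respect to every product $R_1\otimes R_2$ of two probability measures on $\mathcal X\times\mathcal Y$, are Bochner integrable. Then: (a) The operator $M(P)$ is boundedly invertible, and $S$ has a bounded Gâteaux derivative at $P$: there is a linear map $A=S'_G(P)$ from the finite signed measures on $\mathcal X\times\mathcal Y$ to $H$, bounded with respect to the total variation norm, such that for every $Q\in\mathcal M_1(\mathcal X\times\mathcal Y)$ $$\lim_{\varepsilon\downarrow0}\frac{S((1-\varepsilon)P+\varepsilon Q)-S(P)}{\varepsilon}=A(Q-P)=A(Q)=-M(P)^{-1}T(Q;P).$$ (b) For every $Q\in\mathcal M_1(\mathcal X\times\mathcal Y)$ and $\varepsilon\in[0,1]$, with $P_\varepsilon=(1-\varepsilon)P+\varepsilon Q$, the functional $\mathcal R^{\mathrm{reg}}_{P_\varepsilon}$ is Fréchet differentiable at $S(P)=f_{L^*,P,\lambda}$, and $T(Q;P)$ is the derivative in $\varepsilon$ of its gradient there: $$T(Q;P)=\lim_{\varepsilon\downarrow0}\frac{\nabla\mathcal R^{\mathrm{reg}}_{P_\varepsilon}(f_{L^*,P,\lambda})-\nabla\mathcal R^{\mathrm{reg}}_{P}(f_{L^*,P,\lambda})}{\varepsilon}.$$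 -/

import Mathlib

open MeasureTheory Filter Topology Gradient

noncomputable section

namespace PairwiseLearning

/-- The mixture `(1 - ε) P + ε Q` of two probability measures, for `ε ∈ [0, 1]`. -/
def mixture {Z : Type*} [MeasurableSpace Z] (P Q : ProbabilityMeasure Z) (ε : unitInterval) :
    ProbabilityMeasure Z :=
  ⟨ENNReal.ofReal (1 - (ε : ℝ)) • (P : Measure Z) + ENNReal.ofReal (ε : ℝ) • (Q : Measure Z), by
    constructor
    have h0 : (0 : ℝ) ≤ ε := ε.2.1
    have h1 : (0 : ℝ) ≤ 1 - ε := sub_nonneg.2 ε.2.2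
    simp [← ENNReal.ofReal_add h1 h0]⟩

/-- `A` is a bounded Gâteaux derivative at `P` of the map `S` from probability measures to a normed
space: `A` is a linear map on the finite signed measures, bounded for the total variation norm, and
`(S ((1 - ε) P + ε Q) - S P) / ε → A (Q - P)` as `ε ↓ 0`, for every probability measure `Q`. -/
structure IsBoundedGateauxDerivAt {Z : Type*} [MeasurableSpace Z]
    {E : Type*} [NormedAddCommGroup E] [NormedSpace ℝ E]
    (S : ProbabilityMeasure Z → E) (A : SignedMeasure Z →ₗ[ℝ] E) (P : ProbabilityMeasure Z) :
    Prop where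
  bounded : ∃ C : ℝ, ∀ ν : SignedMeasure Z, ‖A ν‖ ≤ C * (ν.totalVariation Set.univ).toReal
  tendsto : ∀ Q : ProbabilityMeasure Z,
    Tendsto (fun ε : unitInterval => (ε : ℝ)⁻¹ • (S (mixture P Q ε) - S P)) (𝓝[≠] 0)
      (𝓝 (A ((Q : Measure Z).toSignedMeasure - (P : Measure Z).toSignedMeasure)))

/-- The requirements on a pairwise loss function `L : (X × Y)² × ℝ → [0, ∞)`: it is measurable,
and in the last argument it is convex, Lipschitz continuous (uniformly in the other arguments), and
twice continuously differentiable with first and second derivatives that are bounded (uniformly in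
all arguments). -/
structure IsAdmissibleLoss {X Y : Type*} [MeasurableSpace X] [MeasurableSpace Y]
    (L : (X × Y) × (X × Y) → ℝ → ℝ) : Prop where
  measurable : Measurable (fun p : ((X × Y) × (X × Y)) × ℝ => L p.1 p.2)
  nonneg : ∀ w t, 0 ≤ L w t
  convex : ∀ w, ConvexOn ℝ Set.univ (L w)
  lipschitz : ∃ c : ℝ, ∀ w t t', |L w t - L w t'| ≤ c * |t - t'|
  contDiff : ∀ w, ContDiff ℝ 2 (L w)
  bounded_deriv : ∃ c : ℝ, ∀ w t, |deriv (L w) t| ≤ c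
  bounded_deriv_deriv : ∃ c : ℝ, ∀ w t, |deriv (deriv (L w)) t| ≤ c

/-- The shifted loss `L*(x, y, x', y', t) = L(x, y, x', y', t) - L(x, y, x', y', 0)`. -/
def shiftedLoss {X Y : Type*} (L : (X × Y) × (X × Y) → ℝ → ℝ) :
    (X × Y) × (X × Y) → ℝ → ℝ :=
  fun w t => L w t - L w 0

section RKHS

variable {X Y : Type*} [MeasurableSpace X] [MeasurableSpace Y]
  {H : Type*} [NormedAddCommGroup H] [InnerProductSpace ℝ H] [RKHS ℝ H (X × X) ℝ]

/-- The value `f(x, x')` at `w = ((x, y), (x', y'))`. -/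
def evalAt (f : H) (w : (X × Y) × (X × Y)) : ℝ := f (w.1.1, w.2.1)

/-- The risk `E_{P ⊗ P}[ℓ(X, Y, X', Y', f(X, X'))]`. -/
def risk (l : (X × Y) × (X × Y) → ℝ → ℝ) (P : ProbabilityMeasure (X × Y)) (f : H) : ℝ :=
  ∫ w, l w (evalAt f w) ∂((P : Measure (X × Y)).prod (P : Measure (X × Y)))

/-- The regularized risk with respect to the shifted loss. -/
def regRisk (L : (X × Y) × (X × Y) → ℝ → ℝ) (lam : ℝ) (P : ProbabilityMeasure (X × Y)) (f : H) :
    ℝ :=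
  risk (shiftedLoss L) P f + lam * ‖f‖ ^ 2

/-- `f` minimizes the regularized risk over the whole space `H`. -/
def IsRegRiskMinimizer (L : (X × Y) × (X × Y) → ℝ → ℝ) (lam : ℝ) (P : ProbabilityMeasure (X × Y))
    (f : H) : Prop :=
  ∀ g : H, regRisk L lam P f ≤ regRisk L lam P g

variable (H) in
/-- The operator `S`, mapping `P` to the minimizer `f_{L*, P, lam}` of the regularized risk. -/
def rplOperator (L : (X × Y) × (X × Y) → ℝ → ℝ) (lam : ℝ) (P : ProbabilityMeasure (X × Y)) : H :=
  Classical.epsilon (IsRegRiskMinimizer L lam P)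

/-- `D₅L(x, y, x', y', f(x, x'))` at `w = ((x, y), (x', y'))`. -/
def lossDeriv (L : (X × Y) × (X × Y) → ℝ → ℝ) (f : H) (w : (X × Y) × (X × Y)) : ℝ :=
  deriv (L w) (evalAt f w)

/-- `D₅D₅L(x, y, x', y', f(x, x'))` at `w = ((x, y), (x', y'))`. -/
def lossDerivDeriv (L : (X × Y) × (X × Y) → ℝ → ℝ) (f : H) (w : (X × Y) × (X × Y)) : ℝ :=
  deriv (deriv (L w)) (evalAt f w)

variable [CompleteSpace H]

variable (H) in
/-- The canonical feature map `Φ(x, x') = k(·, (x, x'))`, evaluated at `w = ((x, y), (x', y'))`. -/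
def feature (w : (X × Y) × (X × Y)) : H := RKHS.kerFun H (w.1.1, w.2.1) 1

/-- The integrand `D₅L(x, y, x', y', f(x, x')) Φ(x, x')`. -/
def gradIntegrand (L : (X × Y) × (X × Y) → ℝ → ℝ) (f : H) (w : (X × Y) × (X × Y)) : H :=
  lossDeriv L f w • feature H w

/-- The integrand `D₅D₅L(x, y, x', y', f(x, x')) ⟨Φ(x, x'), ·⟩ Φ(x, x')`. -/
def hessIntegrand (L : (X × Y) × (X × Y) → ℝ → ℝ) (f : H) (w : (X × Y) × (X × Y)) : H →L[ℝ] H :=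
  lossDerivDeriv L f w • (innerSL ℝ (feature H w)).smulRight (feature H w)

variable (H) in
/-- The vector `T(Q; P)`. -/
def opT (L : (X × Y) × (X × Y) → ℝ → ℝ) (lam : ℝ) (Q P : ProbabilityMeasure (X × Y)) : H :=
  -(2 : ℝ) • (∫ w, gradIntegrand L (rplOperator H L lam P) w
      ∂((P : Measure (X × Y)).prod (P : Measure (X × Y))))
    + (∫ w, gradIntegrand L (rplOperator H L lam P) w
      ∂((P : Measure (X × Y)).prod (Q : Measure (X × Y))))
    + ∫ w, gradIntegrand L (rplOperator H L lam P) w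
      ∂((Q : Measure (X × Y)).prod (P : Measure (X × Y)))

variable (H) in
/-- The operator `M(P)`. -/
def opM (L : (X × Y) × (X × Y) → ℝ → ℝ) (lam : ℝ) (P : ProbabilityMeasure (X × Y)) : H →L[ℝ] H :=
  (2 * lam) • ContinuousLinearMap.id ℝ H
    + ∫ w, hessIntegrand L (rplOperator H L lam P) w
      ∂((P : Measure (X × Y)).prod (P : Measure (X × Y)))

end RKHS

end PairwiseLearning

end

/-!
The gradient of the regularized risk for `P` is
`G_P(f) = 2 λ f + E_{P ⊗ P}[D₅L(f) Φ]`, and everything is read off the equation `G_P(S(P)) = 0`.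

Convexity of the loss gives the quadratic lower bound `regRisk_add_inner_add_le`, so a zero of `G_P`
is the unique minimizer and `G_P` is `2 λ`-strongly monotone. Since `D₅L` is Lipschitz and `Φ` is
bounded, `G_P` is Lipschitz, and it has a zero by the contraction principle
(`exists_eq_zero_of_stronglyMonotone`).

By dominated convergence `G_P` is Fréchet differentiable at every single `f`, with derivative
`2 λ id + E_{P ⊗ P}[D₅D₅L(f) ⟨Φ, ·⟩ Φ]` (`hasFDerivAt_riskGradient`). At `f = S(P)` this is `M(P)`,
which is coercive, hence invertible. Expanding the product of mixtures,
`G_{P_ε} = G_P + ε B + ε² C` with maps `B`, `C` that are continuous in `f` and `B(S(P)) = T(Q; P)`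
(`riskGradient_mixture`); the statement about the derivative of the gradient is immediate from this.
Strong monotonicity of `G_{P_ε}` yields `S(P_ε) - S(P) = O(ε)`
(`rplOperator_mixture_sub_isBigO`), and linearizing `G_P` at `S(P)` in `G_{P_ε}(S(P_ε)) = 0` yields
`(S(P_ε) - S(P)) / ε → -M(P)⁻¹ T(Q; P)` (`tendsto_inv_smul_of_perturbed_zero`). No continuity of
`D₅D₅L` uniform in the observations is needed.

The limit extends to a bounded linear map on signed measures because, by Fubini's theorem, `T(Q; P)`
is the integral against `Q` of a bounded function that does not depend on `Q`
(`integral_gradientInfluence`).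
-/

namespace PairwiseLearning

open scoped InnerProductSpace

/-! ### Zeros of strongly monotone maps -/

section StronglyMonotone

variable {H : Type*} [NormedAddCommGroup H] [InnerProductSpace ℝ H]

/-- A strongly monotone Lipschitz map of a Hilbert space has a zero: `x ↦ x - η F x` is a
contraction for small `η > 0`. -/
theorem exists_eq_zero_of_stronglyMonotone [CompleteSpace H] {F : H → H} {m K : ℝ} (hm : 0 < m)
    (hmono : ∀ x y, m * ‖x - y‖ ^ 2 ≤ ⟪F x - F y, x - y⟫_ℝ)
    (hlip : ∀ x y, ‖F x - F y‖ ≤ K * ‖x - y‖) : ∃ x, F x = 0 := by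
  -- `K` may be smaller than `m` or negative; with `N ≥ m` the number `r` below is nonnegative
  set N : ℝ := |K| + m with hN
  have hmN : m ≤ N := by simp [hN]
  have hN0 : 0 < N := hm.trans_le hmN
  have hlipN : ∀ x y, ‖F x - F y‖ ≤ N * ‖x - y‖ := fun x y => (hlip x y).trans <| by
    gcongr
    linarith [le_abs_self K]
  set η : ℝ := m / N ^ 2 with hη
  have hη0 : 0 < η := by positivity
  set r : ℝ := 1 - m ^ 2 / N ^ 2 with hr
  have hr0 : 0 ≤ r := by
    rw [hr, sub_nonneg, div_le_one (by positivity)]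
    gcongr
  have hr1 : r < 1 := by
    have : 0 < m ^ 2 / N ^ 2 := by positivity
    linarith
  have hT : ContractingWith (√r).toNNReal (fun x => x - η • F x) := by
    refine ⟨?_, LipschitzWith.of_dist_le_mul fun x y => ?_⟩
    · rw [← NNReal.coe_lt_coe, Real.coe_toNNReal _ (Real.sqrt_nonneg _), NNReal.coe_one,
        Real.sqrt_lt' one_pos]
      simpa using hr1
    · rw [Real.coe_toNNReal _ (Real.sqrt_nonneg _), dist_eq_norm, dist_eq_norm]
      have h1 : x - η • F x - (y - η • F y) = (x - y) - η • (F x - F y) := by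
        rw [smul_sub]; abel
      have h2 : ‖(x - y) - η • (F x - F y)‖ ^ 2 ≤ r * ‖x - y‖ ^ 2 := by
        rw [norm_sub_sq_real, inner_smul_right, norm_smul, real_inner_comm, mul_pow,
          Real.norm_eq_abs, sq_abs]
        have h3 : ‖F x - F y‖ ^ 2 ≤ N ^ 2 * ‖x - y‖ ^ 2 := by
          rw [← mul_pow]
          exact pow_le_pow_left₀ (norm_nonneg _) (hlipN x y) 2
        have h4 := mul_le_mul_of_nonneg_left (hmono x y) hη0.le
        have h5 := mul_le_mul_of_nonneg_left h3 (sq_nonneg η)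
        have h6 : r = 1 - 2 * (η * m) + η ^ 2 * N ^ 2 := by
          rw [hr, hη]; field_simp; ring
        rw [h6]
        nlinarith
      rw [h1, ← Real.sqrt_sq (norm_nonneg (x - y)), ← Real.sqrt_mul hr0]
      exact Real.le_sqrt_of_sq_le h2
  refine ⟨hT.fixedPoint _, ?_⟩
  have h := hT.fixedPoint_isFixedPt
  rw [Function.IsFixedPt, sub_eq_self, smul_eq_zero] at h
  exact h.resolve_left hη0.ne'

/-- Sensitivity of a zero to a perturbation: if `u i` solves `G u + ε B u + ε² C u = 0` with
`G x = 0` and `u - x = O(ε)`, then `(u - x) / ε → -G'(x)⁻¹ (B x)`. -/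
theorem tendsto_inv_smul_of_perturbed_zero {ι : Type*} {l : Filter ι} {ε : ι → ℝ}
    (hε : Tendsto ε l (𝓝 0)) (hε0 : ∀ᶠ i in l, ε i ≠ 0) {G B C : H → H} {x : H} {u : ι → H}
    (M : H ≃L[ℝ] H) (hG : HasFDerivAt G (M : H →L[ℝ] H) x) (hGx : G x = 0)
    (hB : ContinuousAt B x) (hC : ContinuousAt C x)
    (hu : ∀ i, G (u i) + ε i • B (u i) + ε i ^ 2 • C (u i) = 0)
    (hux : (fun i => u i - x) =O[l] ε) :
    Tendsto (fun i => (ε i)⁻¹ • (u i - x)) l (𝓝 (-(M.symm (B x)))) := by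
  have hlim : Tendsto u l (𝓝 x) := by
    simpa using (hux.trans_tendsto hε).add_const x
  have hrem : (fun i => G (u i) - G x - M (u i - x)) =o[l] ε :=
    (hG.isLittleO.comp_tendsto hlim).trans_isBigO hux
  have hrem' := hrem.tendsto_inv_smul_nhds_zero
  have hBu : Tendsto (fun i => B (u i)) l (𝓝 (B x)) := hB.tendsto.comp hlim
  have hCu : Tendsto (fun i => ε i • C (u i)) l (𝓝 0) := by
    simpa using hε.smul (hC.tendsto.comp hlim)
  have hM : Tendsto (fun i => M ((ε i)⁻¹ • (u i - x))) l (𝓝 (-(B x))) := by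
    have h := ((hBu.add hCu).add hrem').neg
    simp only [add_zero] at h
    refine h.congr' ?_
    filter_upwards [hε0] with i hi
    have h1 : G (u i) = -(ε i • B (u i) + ε i ^ 2 • C (u i)) := by
      rw [eq_neg_iff_add_eq_zero, ← add_assoc]; exact hu i
    rw [hGx, sub_zero, h1, map_smul, smul_sub, smul_neg, smul_add, smul_smul, smul_smul,
      inv_mul_cancel₀ hi, one_smul]
    have h2 : (ε i)⁻¹ * ε i ^ 2 = ε i := by field_simp
    rw [h2]
    abel
  have h := (M.symm.continuous.tendsto _).comp hM
  simpa only [Function.comp_def, M.symm_apply_apply, map_neg] using h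

/-- Coercive operators on a Hilbert space are invertible. -/
theorem isInvertible_of_coercive [CompleteSpace H] {M : H →L[ℝ] H} {m : ℝ} (hm : 0 < m)
    (hM : ∀ v, m * ‖v‖ ^ 2 ≤ ⟪M v, v⟫_ℝ) : M.IsInvertible := by
  have hco : IsCoercive ((innerSL ℝ).comp M) :=
    ⟨m, hm, fun v => by simpa [pow_two, mul_assoc] using hM v⟩
  refine ⟨hco.continuousLinearEquivOfBilin, ?_⟩
  ext v
  refine ext_inner_right ℝ fun w => ?_
  rw [ContinuousLinearEquiv.coe_coe, hco.continuousLinearEquivOfBilin_apply]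
  rfl

end StronglyMonotone

/-! ### The loss function -/

/-- The partial derivative of a jointly measurable function, differentiable in its real argument,
is jointly measurable, being a limit of difference quotients. -/
theorem measurable_deriv_of_differentiable {W : Type*} [MeasurableSpace W] {l : W → ℝ → ℝ}
    (hl : Measurable (fun p : W × ℝ => l p.1 p.2)) (hd : ∀ w, Differentiable ℝ (l w)) :
    Measurable (fun p : W × ℝ => deriv (l p.1) p.2) := by
  have hu : Tendsto (fun n : ℕ => 1 / ((n : ℝ) + 1)) atTop (𝓝[≠] 0) :=
    tendsto_nhdsWithin_iff.2 ⟨tendsto_one_div_add_atTop_nhds_zero_nat,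
      Eventually.of_forall fun n => (Nat.one_div_pos_of_nat).ne'⟩
  refine measurable_of_tendsto_metrizable
    (f := fun (n : ℕ) (p : W × ℝ) => (1 / ((n : ℝ) + 1))⁻¹ *
      (l p.1 (p.2 + 1 / ((n : ℝ) + 1)) - l p.1 p.2)) (fun n => ?_) (tendsto_pi_nhds.2 fun p => ?_)
  · exact ((hl.comp (measurable_fst.prodMk (measurable_snd.add_const _))).sub hl).const_mul _
  · exact (hasDerivAt_iff_tendsto_slope_zero.1 (hd p.1 p.2).hasDerivAt).comp hu

section Loss

variable {X Y : Type*} [MeasurableSpace X] [MeasurableSpace Y]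
  {L : (X × Y) × (X × Y) → ℝ → ℝ}

theorem IsAdmissibleLoss.differentiable (hL : IsAdmissibleLoss L) (w : (X × Y) × (X × Y)) :
    Differentiable ℝ (L w) :=
  (hL.contDiff w).differentiable (by norm_num)

theorem IsAdmissibleLoss.differentiable_deriv (hL : IsAdmissibleLoss L)
    (w : (X × Y) × (X × Y)) : Differentiable ℝ (deriv (L w)) :=
  (hL.contDiff w).differentiable_deriv_two

theorem IsAdmissibleLoss.measurable_deriv (hL : IsAdmissibleLoss L) :
    Measurable (fun p : ((X × Y) × (X × Y)) × ℝ => deriv (L p.1) p.2) :=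
  measurable_deriv_of_differentiable hL.measurable hL.differentiable

theorem IsAdmissibleLoss.measurable_deriv_deriv (hL : IsAdmissibleLoss L) :
    Measurable (fun p : ((X × Y) × (X × Y)) × ℝ => deriv (deriv (L p.1)) p.2) :=
  measurable_deriv_of_differentiable hL.measurable_deriv hL.differentiable_deriv

theorem IsAdmissibleLoss.deriv_deriv_nonneg (hL : IsAdmissibleLoss L)
    (w : (X × Y) × (X × Y)) (t : ℝ) : 0 ≤ deriv (deriv (L w)) t := by
  have hmono : Monotone (deriv (L w)) := monotoneOn_univ.1 <|
    (hL.convex w).monotoneOn_deriv fun t _ => hL.differentiable w t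
  exact hmono.deriv_nonneg

/-- A convex loss lies above its tangents. -/
theorem IsAdmissibleLoss.deriv_mul_sub_le (hL : IsAdmissibleLoss L)
    (w : (X × Y) × (X × Y)) (s t : ℝ) : deriv (L w) s * (t - s) ≤ L w t - L w s := by
  rcases lt_trichotomy s t with h | rfl | h
  · have := (hL.convex w).deriv_le_slope trivial trivial h (hL.differentiable w s)
    rwa [slope_def_field, le_div_iff₀ (sub_pos.2 h)] at this
  · simp
  · have := (hL.convex w).slope_le_deriv trivial trivial h (hL.differentiable w s)
    rw [slope_def_field, div_le_iff₀ (sub_pos.2 h)] at this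
    linarith

theorem IsAdmissibleLoss.abs_deriv_sub_le (hL : IsAdmissibleLoss L) {c : ℝ}
    (hc : ∀ w t, |deriv (deriv (L w)) t| ≤ c) (w : (X × Y) × (X × Y)) (s t : ℝ) :
    |deriv (L w) s - deriv (L w) t| ≤ c * |s - t| :=
  convex_univ.norm_image_sub_le_of_norm_deriv_le (fun x _ => hL.differentiable_deriv w x)
    (fun x _ => hc w x) trivial trivial

end Loss

/-! ### The feature map -/

section Kernel

variable {Z H : Type*} [NormedAddCommGroup H] [InnerProductSpace ℝ H] [CompleteSpace H]
  [RKHS ℝ H Z ℝ] {k : Z → Z → ℝ}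

theorem inner_kerFun_one_kerFun_one (hkH : ∀ z z', RKHS.kernel H z z' 1 = k z z') (z z' : Z) :
    ⟪RKHS.kerFun H z 1, RKHS.kerFun H z' 1⟫_ℝ = k z z' := by
  rw [RKHS.kerFun_inner, RKHS.kerFun_apply, hkH]
  simp

theorem norm_kerFun_one (hkH : ∀ z z', RKHS.kernel H z z' 1 = k z z') (z : Z) :
    ‖RKHS.kerFun H z (1 : ℝ)‖ = √(k z z) := by
  rw [← inner_kerFun_one_kerFun_one hkH, real_inner_self_eq_norm_sq, Real.sqrt_sq (norm_nonneg _)]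

theorem continuous_kerFun_one [TopologicalSpace Z] (hk : Continuous (fun p : Z × Z => k p.1 p.2))
    (hkH : ∀ z z', RKHS.kernel H z z' 1 = k z z') :
    Continuous (fun z => RKHS.kerFun H z (1 : ℝ)) := by
  refine continuous_iff_continuousAt.2 fun z₀ => tendsto_iff_norm_sub_tendsto_zero.2 ?_
  have h : ∀ z, ‖RKHS.kerFun H z (1 : ℝ) - RKHS.kerFun H z₀ 1‖
      = √(k z z - 2 * k z z₀ + k z₀ z₀) := fun z => by
    rw [← inner_kerFun_one_kerFun_one hkH z z, ← inner_kerFun_one_kerFun_one hkH z z₀,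
      ← inner_kerFun_one_kerFun_one hkH z₀ z₀, real_inner_self_eq_norm_sq,
      real_inner_self_eq_norm_sq, ← norm_sub_sq_real, Real.sqrt_sq (norm_nonneg _)]
  simp_rw [h]
  have hc : Continuous (fun z => √(k z z - 2 * k z z₀ + k z₀ z₀)) := by
    have h1 : Continuous (fun z => k z z) := hk.comp (continuous_id.prodMk continuous_id)
    have h2 : Continuous (fun z => k z z₀) := hk.comp (continuous_id.prodMk continuous_const)
    fun_prop
  have := hc.tendsto z₀
  rwa [show k z₀ z₀ - 2 * k z₀ z₀ + k z₀ z₀ = 0 by ring, Real.sqrt_zero] at this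

end Kernel

section Evaluation

variable {X Y : Type*} {H : Type*} [NormedAddCommGroup H] [InnerProductSpace ℝ H]
  [RKHS ℝ H (X × X) ℝ]

theorem evalAt_sub (f g : H) (w : (X × Y) × (X × Y)) :
    evalAt (f - g) w = evalAt f w - evalAt g w := by
  simp [evalAt]

variable [CompleteSpace H]

theorem evalAt_eq_inner (f : H) (w : (X × Y) × (X × Y)) : evalAt f w = ⟪feature H w, f⟫_ℝ := by
  simp [evalAt, feature]

theorem abs_evalAt_le {κ : ℝ} (hκ : ∀ w : (X × Y) × (X × Y), ‖feature H w‖ ≤ κ) (f : H)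
    (w : (X × Y) × (X × Y)) : |evalAt f w| ≤ κ * ‖f‖ := by
  rw [evalAt_eq_inner]
  exact (abs_real_inner_le_norm _ _).trans (by gcongr; exact hκ w)

theorem hasFDerivAt_evalAt (w : (X × Y) × (X × Y)) (f : H) :
    HasFDerivAt (fun f : H => evalAt f w) (innerSL ℝ (feature H w)) f := by
  simp_rw [evalAt_eq_inner]
  exact (innerSL ℝ (feature H w)).hasFDerivAt

theorem hessIntegrand_apply (L : (X × Y) × (X × Y) → ℝ → ℝ) (f v : H) (w : (X × Y) × (X × Y)) :
    hessIntegrand L f w v = lossDerivDeriv L f w • evalAt v w • feature H w := by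
  rw [evalAt_eq_inner]
  rfl

end Evaluation

section Risk

variable {X Y : Type*} [MeasurableSpace X] [MeasurableSpace Y]
  {H : Type*} [NormedAddCommGroup H] [InnerProductSpace ℝ H] [CompleteSpace H]
  [RKHS ℝ H (X × X) ℝ]
  {L : (X × Y) × (X × Y) → ℝ → ℝ} {κ lam : ℝ}

theorem measurable_evalAt (hΦ : StronglyMeasurable (feature H : (X × Y) × (X × Y) → H)) (f : H) :
    Measurable (evalAt f : (X × Y) × (X × Y) → ℝ) := by
  simp_rw [funext (evalAt_eq_inner f)]
  exact (hΦ.inner stronglyMeasurable_const).measurable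

/-! ### Integrability -/

theorem stronglyMeasurable_lossDeriv
    (hΦ : StronglyMeasurable (feature H : (X × Y) × (X × Y) → H)) (hL : IsAdmissibleLoss L)
    (f : H) : StronglyMeasurable (lossDeriv L f) :=
  (hL.measurable_deriv.comp (measurable_id.prodMk (measurable_evalAt hΦ f))).stronglyMeasurable

theorem stronglyMeasurable_gradIntegrand
    (hΦ : StronglyMeasurable (feature H : (X × Y) × (X × Y) → H)) (hL : IsAdmissibleLoss L)
    (f : H) : StronglyMeasurable (gradIntegrand L f) :=
  (stronglyMeasurable_lossDeriv hΦ hL f).smul hΦ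

theorem stronglyMeasurable_hessIntegrand
    (hΦ : StronglyMeasurable (feature H : (X × Y) × (X × Y) → H)) (hL : IsAdmissibleLoss L)
    (f : H) : StronglyMeasurable (hessIntegrand L f) := by
  have hc : Continuous (fun v : H => (innerSL ℝ v).smulRight v) :=
    (ContinuousLinearMap.smulRightL ℝ H H).continuous₂.comp
      ((innerSL ℝ).continuous.prodMk continuous_id)
  exact (hL.measurable_deriv_deriv.comp
    (measurable_id.prodMk (measurable_evalAt hΦ f))).stronglyMeasurable.smul
      (hc.comp_stronglyMeasurable hΦ)

theorem exists_norm_gradIntegrand_le (hκ : ∀ w : (X × Y) × (X × Y), ‖feature H w‖ ≤ κ)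
    (hL : IsAdmissibleLoss L) : ∃ C, ∀ (f : H) w, ‖gradIntegrand L f w‖ ≤ C := by
  obtain ⟨c, hc⟩ := hL.bounded_deriv
  refine ⟨c * κ, fun f w => ?_⟩
  rw [gradIntegrand, norm_smul]
  exact mul_le_mul (hc _ _) (hκ w) (norm_nonneg _) ((abs_nonneg _).trans (hc w 0))

theorem exists_norm_gradIntegrand_sub_le (hκ : ∀ w : (X × Y) × (X × Y), ‖feature H w‖ ≤ κ)
    (hL : IsAdmissibleLoss L) :
    ∃ C, ∀ (f g : H) w, ‖gradIntegrand L f w - gradIntegrand L g w‖ ≤ C * ‖f - g‖ := by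
  obtain ⟨c, hc⟩ := hL.bounded_deriv_deriv
  refine ⟨c * κ * κ, fun f g w => ?_⟩
  have hc0 : 0 ≤ c := (abs_nonneg _).trans (hc w 0)
  rw [gradIntegrand, gradIntegrand, ← sub_smul, norm_smul]
  calc ‖lossDeriv L f w - lossDeriv L g w‖ * ‖feature H w‖
      ≤ (c * (κ * ‖f - g‖)) * κ := by
        have hκ0 : 0 ≤ κ := (norm_nonneg _).trans (hκ w)
        refine mul_le_mul ((hL.abs_deriv_sub_le hc w _ _).trans ?_) (hκ w) (norm_nonneg _)
          (by positivity)
        rw [← evalAt_sub]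
        gcongr
        exact abs_evalAt_le hκ _ w
    _ = c * κ * κ * ‖f - g‖ := by ring

theorem exists_norm_hessIntegrand_le (hκ : ∀ w : (X × Y) × (X × Y), ‖feature H w‖ ≤ κ)
    (hL : IsAdmissibleLoss L) : ∃ C, ∀ (f : H) w, ‖hessIntegrand L f w‖ ≤ C := by
  obtain ⟨c, hc⟩ := hL.bounded_deriv_deriv
  refine ⟨c * (κ * κ), fun f w => ?_⟩
  have hκ0 : 0 ≤ κ := (norm_nonneg _).trans (hκ w)
  rw [hessIntegrand, norm_smul, ContinuousLinearMap.norm_smulRight_apply, innerSL_apply_norm]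
  exact mul_le_mul (hc _ _) (mul_le_mul (hκ w) (hκ w) (norm_nonneg _) hκ0) (by positivity)
    ((abs_nonneg _).trans (hc w 0))

section Integrals

variable {μ : Measure ((X × Y) × (X × Y))} [IsFiniteMeasure μ]

theorem integrable_gradIntegrand (hΦ : StronglyMeasurable (feature H : (X × Y) × (X × Y) → H))
    (hκ : ∀ w : (X × Y) × (X × Y), ‖feature H w‖ ≤ κ) (hL : IsAdmissibleLoss L) (f : H) :
    Integrable (gradIntegrand L f) μ :=
  have ⟨C, hC⟩ := exists_norm_gradIntegrand_le (H := H) hκ hL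
  .of_bound (stronglyMeasurable_gradIntegrand hΦ hL f).aestronglyMeasurable C
    (.of_forall (hC f))

theorem integrable_hessIntegrand (hΦ : StronglyMeasurable (feature H : (X × Y) × (X × Y) → H))
    (hκ : ∀ w : (X × Y) × (X × Y), ‖feature H w‖ ≤ κ) (hL : IsAdmissibleLoss L) (f : H) :
    Integrable (hessIntegrand L f) μ :=
  have ⟨C, hC⟩ := exists_norm_hessIntegrand_le (H := H) hκ hL
  .of_bound (stronglyMeasurable_hessIntegrand hΦ hL f).aestronglyMeasurable C
    (.of_forall (hC f))

theorem stronglyMeasurable_shiftedLoss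
    (hΦ : StronglyMeasurable (feature H : (X × Y) × (X × Y) → H)) (hL : IsAdmissibleLoss L)
    (f : H) : StronglyMeasurable (fun w => shiftedLoss L w (evalAt f w)) :=
  ((hL.measurable.comp (measurable_id.prodMk (measurable_evalAt hΦ f))).sub
    (hL.measurable.comp (measurable_id.prodMk measurable_const))).stronglyMeasurable

theorem exists_abs_shiftedLoss_sub_le (hκ : ∀ w : (X × Y) × (X × Y), ‖feature H w‖ ≤ κ)
    (hL : IsAdmissibleLoss L) : ∃ C, ∀ (f g : H) w,
      ‖shiftedLoss L w (evalAt f w) - shiftedLoss L w (evalAt g w)‖ ≤ C * ‖f - g‖ := by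
  obtain ⟨c, hc⟩ := hL.lipschitz
  refine ⟨c * κ, fun f g w => ?_⟩
  have hc0 : 0 ≤ c := (abs_nonneg _).trans (by simpa using hc w 1 0)
  rw [shiftedLoss, shiftedLoss, sub_sub_sub_cancel_right, Real.norm_eq_abs, mul_assoc]
  refine (hc w _ _).trans ?_
  rw [← evalAt_sub]
  gcongr
  exact abs_evalAt_le hκ _ w

/-- The shift makes the loss integrable without any moment assumption on the measure. -/
theorem integrable_shiftedLoss (hΦ : StronglyMeasurable (feature H : (X × Y) × (X × Y) → H))
    (hκ : ∀ w : (X × Y) × (X × Y), ‖feature H w‖ ≤ κ) (hL : IsAdmissibleLoss L) (f : H) :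
    Integrable (fun w => shiftedLoss L w (evalAt f w)) μ := by
  obtain ⟨C, hC⟩ := exists_abs_shiftedLoss_sub_le (H := H) hκ hL
  refine .of_bound (stronglyMeasurable_shiftedLoss hΦ hL f).aestronglyMeasurable (C * ‖f‖)
    (.of_forall fun w => ?_)
  simpa [shiftedLoss, evalAt] using hC f 0 w

/-! ### Derivatives of the risk -/

theorem hasGradientAt_integral_shiftedLoss
    (hΦ : StronglyMeasurable (feature H : (X × Y) × (X × Y) → H))
    (hκ : ∀ w : (X × Y) × (X × Y), ‖feature H w‖ ≤ κ) (hL : IsAdmissibleLoss L) (f : H) :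
    HasGradientAt (fun g : H => ∫ w, shiftedLoss L w (evalAt g w) ∂μ)
      (∫ w, gradIntegrand L f w ∂μ) f := by
  obtain ⟨C, hC⟩ := exists_abs_shiftedLoss_sub_le (H := H) hκ hL
  rw [hasGradientAt_iff_hasFDerivAt]
  have h := (hasFDerivAt_integral_of_dominated_loc_of_lip' (μ := μ) (𝕜 := ℝ) (x₀ := f)
    (F := fun (g : H) w => shiftedLoss L w (evalAt g w))
    (F' := fun w => innerSL ℝ (gradIntegrand L f w)) (bound := fun _ => C) univ_mem
    (fun g _ => (stronglyMeasurable_shiftedLoss hΦ hL g).aestronglyMeasurable)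
    (integrable_shiftedLoss hΦ hκ hL f)
    ((innerSL ℝ).continuous.comp_stronglyMeasurable
      (stronglyMeasurable_gradIntegrand hΦ hL f)).aestronglyMeasurable
    (.of_forall fun w g _ => hC g f w) (integrable_const C) (.of_forall fun w => ?_)).2
  · have hcomm := (innerSL ℝ (E := H)).integral_comp_comm
      (integrable_gradIntegrand (μ := μ) hΦ hκ hL f)
    rw [hcomm] at h
    exact h
  · have h1 : HasDerivAt (shiftedLoss L w) (lossDeriv L f w) (evalAt f w) :=
      (hL.differentiable w _).hasDerivAt.sub_const _
    have h2 := h1.comp_hasFDerivAt f (hasFDerivAt_evalAt w f)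
    rw [gradIntegrand, map_smul]
    exact h2

/-- The second derivative need not be equicontinuous in the remaining arguments of the loss, so
differentiability is obtained by dominated convergence at a fixed `f`. -/
theorem hasFDerivAt_integral_gradIntegrand
    (hΦ : StronglyMeasurable (feature H : (X × Y) × (X × Y) → H))
    (hκ : ∀ w : (X × Y) × (X × Y), ‖feature H w‖ ≤ κ) (hL : IsAdmissibleLoss L) (f : H) :
    HasFDerivAt (fun g : H => ∫ w, gradIntegrand L g w ∂μ) (∫ w, hessIntegrand L f w ∂μ) f := by
  obtain ⟨C, hC⟩ := exists_norm_gradIntegrand_sub_le (H := H) hκ hL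
  refine (hasFDerivAt_integral_of_dominated_loc_of_lip' (bound := fun _ => C) univ_mem
    (fun g _ => (stronglyMeasurable_gradIntegrand hΦ hL g).aestronglyMeasurable)
    (integrable_gradIntegrand hΦ hκ hL f)
    (stronglyMeasurable_hessIntegrand hΦ hL f).aestronglyMeasurable
    (.of_forall fun w g _ => hC g f w) (integrable_const C) (.of_forall fun w => ?_)).2
  have h1 : HasDerivAt (deriv (L w)) (lossDerivDeriv L f w) (evalAt f w) :=
    (hL.differentiable_deriv w _).hasDerivAt
  have h2 := (h1.comp_hasFDerivAt f (hasFDerivAt_evalAt w f)).smul_const (feature H w)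
  have h3 : hessIntegrand L f w =
      (lossDerivDeriv L f w • innerSL ℝ (feature H w)).smulRight (feature H w) :=
    ContinuousLinearMap.ext fun v => by
      rw [hessIntegrand_apply, evalAt_eq_inner, smul_smul]
      rfl
  rw [h3]
  exact h2

/-- The gradient `2 λ f + ∫ L'(f) Φ dμ` at `f` of the functional
`f ↦ ∫ L*(f) dμ + λ ‖f‖²`, for a measure `μ` on pairs of observations. -/
noncomputable def riskGradient (L : (X × Y) × (X × Y) → ℝ → ℝ) (lam : ℝ)
    (μ : Measure ((X × Y) × (X × Y))) (f : H) : H :=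
  (2 * lam) • f + ∫ w, gradIntegrand L f w ∂μ

theorem hasFDerivAt_riskGradient
    (hΦ : StronglyMeasurable (feature H : (X × Y) × (X × Y) → H))
    (hκ : ∀ w : (X × Y) × (X × Y), ‖feature H w‖ ≤ κ) (hL : IsAdmissibleLoss L) (f : H) :
    HasFDerivAt (riskGradient L lam μ)
      ((2 * lam) • ContinuousLinearMap.id ℝ H + ∫ w, hessIntegrand L f w ∂μ) f :=
  ((hasFDerivAt_id f).const_smul (2 * lam)).add (hasFDerivAt_integral_gradIntegrand hΦ hκ hL f)

theorem exists_norm_riskGradient_sub_le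
    (hΦ : StronglyMeasurable (feature H : (X × Y) × (X × Y) → H))
    (hκ : ∀ w : (X × Y) × (X × Y), ‖feature H w‖ ≤ κ) (hL : IsAdmissibleLoss L) :
    ∃ K, ∀ f g : H, ‖riskGradient L lam μ f - riskGradient L lam μ g‖ ≤ K * ‖f - g‖ := by
  obtain ⟨C, hC⟩ := exists_norm_gradIntegrand_sub_le (H := H) hκ hL
  refine ⟨‖2 * lam‖ + C * μ.real Set.univ, fun f g => ?_⟩
  have h : riskGradient L lam μ f - riskGradient L lam μ g = (2 * lam) • (f - g)
      + ∫ w, (gradIntegrand L f w - gradIntegrand L g w) ∂μ := by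
    rw [integral_sub (integrable_gradIntegrand hΦ hκ hL f)
      (integrable_gradIntegrand hΦ hκ hL g), riskGradient, riskGradient, smul_sub]
    abel
  rw [h]
  refine (norm_add_le _ _).trans ?_
  have h1 : ‖∫ w, (gradIntegrand L f w - gradIntegrand L g w) ∂μ‖
      ≤ C * ‖f - g‖ * μ.real Set.univ :=
    norm_integral_le_of_norm_le_const (.of_forall (hC f g))
  rw [norm_smul]
  linarith

/-- The Hessian of the regularized risk is coercive since the loss is convex. -/
theorem inner_hessian_ge (hΦ : StronglyMeasurable (feature H : (X × Y) × (X × Y) → H))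
    (hκ : ∀ w : (X × Y) × (X × Y), ‖feature H w‖ ≤ κ) (hL : IsAdmissibleLoss L) (f v : H) :
    2 * lam * ‖v‖ ^ 2 ≤
      ⟪((2 * lam) • ContinuousLinearMap.id ℝ H + ∫ w, hessIntegrand L f w ∂μ) v, v⟫_ℝ := by
  have hint := integrable_hessIntegrand (μ := μ) hΦ hκ hL f
  have h : 0 ≤ ⟪(∫ w, hessIntegrand L f w ∂μ) v, v⟫_ℝ := by
    rw [ContinuousLinearMap.integral_apply hint, real_inner_comm,
      ← integral_inner (hint.apply_continuousLinearMap v)]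
    refine integral_nonneg fun w => ?_
    rw [hessIntegrand_apply, inner_smul_right, inner_smul_right, real_inner_comm,
      ← evalAt_eq_inner]
    exact mul_nonneg (hL.deriv_deriv_nonneg w _) (mul_self_nonneg _)
  simpa [inner_add_left, inner_smul_left, pow_two] using h

end Integrals

end Risk

/-! ### Minimizers of the regularized risk -/

section Minimizer

variable {X Y : Type*} [MeasurableSpace X] [MeasurableSpace Y]
  {H : Type*} [NormedAddCommGroup H] [InnerProductSpace ℝ H] [CompleteSpace H]
  [RKHS ℝ H (X × X) ℝ]
  {L : (X × Y) × (X × Y) → ℝ → ℝ} {κ lam : ℝ}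

/-- The regularized risk is strongly convex, in the form of a quadratic lower bound. Existence,
uniqueness and stability of its minimizer all follow from this inequality. -/
theorem regRisk_add_inner_add_le (hΦ : StronglyMeasurable (feature H : (X × Y) × (X × Y) → H))
    (hκ : ∀ w : (X × Y) × (X × Y), ‖feature H w‖ ≤ κ) (hL : IsAdmissibleLoss L)
    (P : ProbabilityMeasure (X × Y)) (f g : H) :
    regRisk L lam P f
      + ⟪riskGradient L lam ((P : Measure (X × Y)).prod (P : Measure (X × Y))) f, g - f⟫_ℝ
      + lam * ‖g - f‖ ^ 2 ≤ regRisk L lam P g := by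
  set μ := (P : Measure (X × Y)).prod (P : Measure (X × Y)) with hμ
  have hg := integrable_gradIntegrand (μ := μ) hΦ hκ hL f
  have hrisk : ⟪∫ w, gradIntegrand L f w ∂μ, g - f⟫_ℝ
      ≤ risk (shiftedLoss L) P g - risk (shiftedLoss L) P f := by
    rw [risk, risk, ← hμ, ← integral_sub (integrable_shiftedLoss hΦ hκ hL g)
      (integrable_shiftedLoss hΦ hκ hL f), real_inner_comm, ← integral_inner hg]
    refine integral_mono (hg.const_inner _) ((integrable_shiftedLoss hΦ hκ hL g).sub
      (integrable_shiftedLoss hΦ hκ hL f)) fun w => ?_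
    have h := hL.deriv_mul_sub_le w (evalAt f w) (evalAt g w)
    rw [← evalAt_sub, evalAt_eq_inner (g - f)] at h
    simp only [gradIntegrand, inner_smul_right, shiftedLoss, sub_sub_sub_cancel_right]
    rwa [real_inner_comm]
  have hsq : ‖g‖ ^ 2 = ‖f‖ ^ 2 + 2 * ⟪f, g - f⟫_ℝ + ‖g - f‖ ^ 2 := by
    rw [← norm_add_sq_real, add_sub_cancel]
  rw [regRisk, regRisk, riskGradient, inner_add_left, real_inner_smul_left, hsq]
  linarith

theorem two_mul_norm_sub_sq_le_inner_riskGradient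
    (hΦ : StronglyMeasurable (feature H : (X × Y) × (X × Y) → H))
    (hκ : ∀ w : (X × Y) × (X × Y), ‖feature H w‖ ≤ κ) (hL : IsAdmissibleLoss L)
    (P : ProbabilityMeasure (X × Y)) (f g : H) :
    2 * lam * ‖f - g‖ ^ 2 ≤
      ⟪riskGradient L lam ((P : Measure (X × Y)).prod (P : Measure (X × Y))) f
        - riskGradient L lam ((P : Measure (X × Y)).prod (P : Measure (X × Y))) g, f - g⟫_ℝ := by
  have h1 := regRisk_add_inner_add_le (lam := lam) hΦ hκ hL P f g
  have h2 := regRisk_add_inner_add_le (lam := lam) hΦ hκ hL P g f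
  rw [norm_sub_rev, ← neg_sub f g, inner_neg_right] at h1
  rw [inner_sub_left]
  linarith

theorem norm_sub_le_norm_riskGradient_sub
    (hΦ : StronglyMeasurable (feature H : (X × Y) × (X × Y) → H))
    (hκ : ∀ w : (X × Y) × (X × Y), ‖feature H w‖ ≤ κ) (hL : IsAdmissibleLoss L)
    (P : ProbabilityMeasure (X × Y)) (f g : H) :
    2 * lam * ‖f - g‖ ≤
      ‖riskGradient L lam ((P : Measure (X × Y)).prod (P : Measure (X × Y))) f
        - riskGradient L lam ((P : Measure (X × Y)).prod (P : Measure (X × Y))) g‖ := by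
  rcases (norm_nonneg (f - g)).eq_or_lt with h0 | h0
  · rw [← h0, mul_zero]
    exact norm_nonneg _
  · refine le_of_mul_le_mul_right ?_ h0
    have h := (two_mul_norm_sub_sq_le_inner_riskGradient (lam := lam) hΦ hκ hL P f g).trans
      (real_inner_le_norm _ _)
    rwa [pow_two, ← mul_assoc] at h

theorem isRegRiskMinimizer_of_riskGradient_eq_zero (hlam : 0 < lam)
    (hΦ : StronglyMeasurable (feature H : (X × Y) × (X × Y) → H))
    (hκ : ∀ w : (X × Y) × (X × Y), ‖feature H w‖ ≤ κ) (hL : IsAdmissibleLoss L)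
    {P : ProbabilityMeasure (X × Y)} {f : H}
    (hf : riskGradient L lam ((P : Measure (X × Y)).prod (P : Measure (X × Y))) f = 0) :
    IsRegRiskMinimizer L lam P f ∧ ∀ g, IsRegRiskMinimizer L lam P g → g = f := by
  have h : ∀ g, regRisk L lam P f + lam * ‖g - f‖ ^ 2 ≤ regRisk L lam P g := fun g => by
    simpa [hf] using regRisk_add_inner_add_le (lam := lam) hΦ hκ hL P f g
  refine ⟨fun g => le_trans (le_add_of_nonneg_right (by positivity)) (h g), fun g hg => ?_⟩
  have h1 : lam * ‖g - f‖ ^ 2 ≤ 0 := by linarith [h g, hg f]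
  have h2 : ‖g - f‖ ^ 2 = 0 := le_antisymm (nonpos_of_mul_nonpos_right h1 hlam) (sq_nonneg _)
  simpa [sub_eq_zero] using h2

theorem isRegRiskMinimizer_rplOperator (hlam : 0 < lam)
    (hΦ : StronglyMeasurable (feature H : (X × Y) × (X × Y) → H))
    (hκ : ∀ w : (X × Y) × (X × Y), ‖feature H w‖ ≤ κ) (hL : IsAdmissibleLoss L)
    (P : ProbabilityMeasure (X × Y)) :
    riskGradient L lam ((P : Measure (X × Y)).prod (P : Measure (X × Y)))
        (rplOperator H L lam P) = 0 ∧
      IsRegRiskMinimizer L lam P (rplOperator H L lam P) ∧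
      ∀ g : H, IsRegRiskMinimizer L lam P g → g = rplOperator H L lam P := by
  obtain ⟨K, hK⟩ := exists_norm_riskGradient_sub_le (lam := lam)
    (μ := (P : Measure (X × Y)).prod (P : Measure (X × Y))) hΦ hκ hL
  obtain ⟨f, hf⟩ := exists_eq_zero_of_stronglyMonotone (by positivity : 0 < 2 * lam)
    (two_mul_norm_sub_sq_le_inner_riskGradient hΦ hκ hL P) hK
  have hmin := isRegRiskMinimizer_of_riskGradient_eq_zero hlam hΦ hκ hL hf
  have hspec : IsRegRiskMinimizer L lam P (rplOperator H L lam P) :=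
    Classical.epsilon_spec ⟨f, hmin.1⟩
  have heq : rplOperator H L lam P = f := hmin.2 _ hspec
  rw [heq]
  exact ⟨hf, hmin⟩

theorem hasGradientAt_regRisk (hΦ : StronglyMeasurable (feature H : (X × Y) × (X × Y) → H))
    (hκ : ∀ w : (X × Y) × (X × Y), ‖feature H w‖ ≤ κ) (hL : IsAdmissibleLoss L)
    (P : ProbabilityMeasure (X × Y)) (f : H) :
    HasGradientAt (regRisk L lam P)
      (riskGradient L lam ((P : Measure (X × Y)).prod (P : Measure (X × Y))) f) f := by
  have h1 := (hasGradientAt_integral_shiftedLoss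
    (μ := (P : Measure (X × Y)).prod (P : Measure (X × Y))) hΦ hκ hL f).hasFDerivAt
  have h2 := ((hasStrictFDerivAt_norm_sq f).hasFDerivAt).const_mul lam
  have h3 : InnerProductSpace.toDual ℝ H
      (riskGradient L lam ((P : Measure (X × Y)).prod (P : Measure (X × Y))) f)
      = InnerProductSpace.toDual ℝ H
          (∫ w, gradIntegrand L f w ∂((P : Measure (X × Y)).prod (P : Measure (X × Y))))
        + lam • (2 • innerSL ℝ f) := by
    refine ContinuousLinearMap.ext fun v => ?_
    simp only [riskGradient, map_add, map_smul, FunLike.coe_add, FunLike.coe_smul, Pi.add_apply,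
      Pi.smul_apply, InnerProductSpace.toDual_apply_apply, innerSL_apply_apply, smul_eq_mul,
      two_nsmul]
    ring
  rw [hasGradientAt_iff_hasFDerivAt, h3]
  exact h1.add h2

end Minimizer

/-! ### Mixtures -/

theorem integral_mixture_prod_mixture {Z E : Type*} [MeasurableSpace Z] [NormedAddCommGroup E]
    [NormedSpace ℝ E] (P Q : ProbabilityMeasure Z) (ε : unitInterval) {g : Z × Z → E}
    (hPP : Integrable g ((P : Measure Z).prod P)) (hPQ : Integrable g ((P : Measure Z).prod Q))
    (hQP : Integrable g ((Q : Measure Z).prod P)) (hQQ : Integrable g ((Q : Measure Z).prod Q)) :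
    ∫ w, g w ∂((mixture P Q ε : Measure Z).prod (mixture P Q ε : Measure Z))
      = ∫ w, g w ∂((P : Measure Z).prod P)
        + (ε : ℝ) • (-(2 : ℝ) • ∫ w, g w ∂((P : Measure Z).prod P)
            + ∫ w, g w ∂((P : Measure Z).prod Q) + ∫ w, g w ∂((Q : Measure Z).prod P))
        + (ε : ℝ) ^ 2 • (∫ w, g w ∂((P : Measure Z).prod P) - ∫ w, g w ∂((P : Measure Z).prod Q)
            - ∫ w, g w ∂((Q : Measure Z).prod P) + ∫ w, g w ∂((Q : Measure Z).prod Q)) := by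
  have hmix : (mixture P Q ε : Measure Z)
      = ENNReal.ofReal (1 - (ε : ℝ)) • (P : Measure Z) + ENNReal.ofReal (ε : ℝ) • (Q : Measure Z) :=
    rfl
  have h0 : (0 : ℝ) ≤ ε := ε.2.1
  have h1 : (0 : ℝ) ≤ 1 - ε := sub_nonneg.2 ε.2.2
  have hI : ∀ {μ : Measure (Z × Z)} (r s : ℝ), Integrable g μ →
      Integrable g (ENNReal.ofReal r • ENNReal.ofReal s • μ) := fun r s h =>
    (h.smul_measure ENNReal.ofReal_ne_top).smul_measure ENNReal.ofReal_ne_top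
  rw [hmix, Measure.prod_add, Measure.add_prod, Measure.add_prod]
  simp only [Measure.prod_smul_left, Measure.prod_smul_right]
  rw [integral_add_measure ((hI _ _ hPP).add_measure (hI _ _ hQP))
      ((hI _ _ hPQ).add_measure (hI _ _ hQQ)),
    integral_add_measure (hI _ _ hPP) (hI _ _ hQP),
    integral_add_measure (hI _ _ hPQ) (hI _ _ hQQ)]
  simp only [integral_smul_measure, ENNReal.toReal_ofReal h0, ENNReal.toReal_ofReal h1]
  module

/-! ### Integration against signed measures -/

section SignedMeasure

variable {Z E : Type*} [MeasurableSpace Z] [NormedAddCommGroup E] [NormedSpace ℝ E]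

instance isFiniteMeasure_variation (ν : SignedMeasure Z) : IsFiniteMeasure ν.variation := by
  rw [← ν.totalVariation_eq_variation]
  infer_instance

/-- Integration of a bounded strongly measurable function, as a linear map on the signed
measures. -/
noncomputable def signedIntegral (g : Z → E) (hg : StronglyMeasurable g) {C : ℝ}
    (hC : ∀ z, ‖g z‖ ≤ C) : SignedMeasure Z →ₗ[ℝ] E where
  toFun ν := ν.integral g (ContinuousLinearMap.lsmul ℝ ℝ).flip
  map_add' _ _ := VectorMeasure.integral_add_vectorMeasure
    (.of_bound hg.aestronglyMeasurable C (.of_forall hC))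
    (.of_bound hg.aestronglyMeasurable C (.of_forall hC))
  map_smul' c _ := VectorMeasure.integral_smul_vectorMeasure g c

theorem signedIntegral_toSignedMeasure {g : Z → E} (hg : StronglyMeasurable g) {C : ℝ}
    (hC : ∀ z, ‖g z‖ ≤ C) (μ : Measure Z) [IsFiniteMeasure μ] :
    signedIntegral g hg hC μ.toSignedMeasure = ∫ z, g z ∂μ :=
  VectorMeasure.integral_toSignedMeasure

theorem norm_signedIntegral_le {g : Z → E} (hg : StronglyMeasurable g) {C : ℝ}
    (hC : ∀ z, ‖g z‖ ≤ C) (ν : SignedMeasure Z) :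
    ‖signedIntegral g hg hC ν‖ ≤
      C * ‖(ContinuousLinearMap.lsmul ℝ ℝ (E := E)).flip‖
        * (ν.totalVariation Set.univ).toReal := by
  rw [ν.totalVariation_eq_variation]
  exact VectorMeasure.norm_integral_le_of_norm_le_const (.of_forall hC)

end SignedMeasure

/-! ### The Gâteaux derivative -/

section Gateaux

variable {X Y : Type*} [MeasurableSpace X] [MeasurableSpace Y]
  {H : Type*} [NormedAddCommGroup H] [InnerProductSpace ℝ H] [CompleteSpace H]
  [RKHS ℝ H (X × X) ℝ]
  {L : (X × Y) × (X × Y) → ℝ → ℝ} {κ lam : ℝ}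

/-- The coefficient of `ε` in the gradient of the regularized risk at `f` under the mixture
`(1 - ε) P + ε Q`. At the minimizer for `P` it is the vector `T(Q; P)`. -/
noncomputable def gradientVariation (L : (X × Y) × (X × Y) → ℝ → ℝ)
    (P Q : ProbabilityMeasure (X × Y)) (f : H) : H :=
  -(2 : ℝ) • (∫ w, gradIntegrand L f w ∂((P : Measure (X × Y)).prod (P : Measure (X × Y))))
    + (∫ w, gradIntegrand L f w ∂((P : Measure (X × Y)).prod (Q : Measure (X × Y))))
    + ∫ w, gradIntegrand L f w ∂((Q : Measure (X × Y)).prod (P : Measure (X × Y)))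

/-- The coefficient of `ε²` in the gradient of the regularized risk at `f` under the mixture
`(1 - ε) P + ε Q`. -/
noncomputable def gradientSecondVariation (L : (X × Y) × (X × Y) → ℝ → ℝ)
    (P Q : ProbabilityMeasure (X × Y)) (f : H) : H :=
  (∫ w, gradIntegrand L f w ∂((P : Measure (X × Y)).prod (P : Measure (X × Y))))
    - (∫ w, gradIntegrand L f w ∂((P : Measure (X × Y)).prod (Q : Measure (X × Y))))
    - (∫ w, gradIntegrand L f w ∂((Q : Measure (X × Y)).prod (P : Measure (X × Y))))
    + ∫ w, gradIntegrand L f w ∂((Q : Measure (X × Y)).prod (Q : Measure (X × Y)))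

theorem riskGradient_mixture (hΦ : StronglyMeasurable (feature H : (X × Y) × (X × Y) → H))
    (hκ : ∀ w : (X × Y) × (X × Y), ‖feature H w‖ ≤ κ) (hL : IsAdmissibleLoss L)
    (P Q : ProbabilityMeasure (X × Y)) (ε : unitInterval) (f : H) :
    riskGradient L lam ((mixture P Q ε : Measure (X × Y)).prod (mixture P Q ε : Measure (X × Y))) f
      = riskGradient L lam ((P : Measure (X × Y)).prod (P : Measure (X × Y))) f
        + (ε : ℝ) • gradientVariation L P Q f + (ε : ℝ) ^ 2 • gradientSecondVariation L P Q f := by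
  rw [riskGradient, integral_mixture_prod_mixture P Q ε
    (integrable_gradIntegrand hΦ hκ hL f) (integrable_gradIntegrand hΦ hκ hL f)
    (integrable_gradIntegrand hΦ hκ hL f) (integrable_gradIntegrand hΦ hκ hL f),
    ← add_assoc, ← add_assoc]
  rfl

theorem continuous_integral_gradIntegrand
    (hΦ : StronglyMeasurable (feature H : (X × Y) × (X × Y) → H))
    (hκ : ∀ w : (X × Y) × (X × Y), ‖feature H w‖ ≤ κ) (hL : IsAdmissibleLoss L)
    (μ : Measure ((X × Y) × (X × Y))) [IsFiniteMeasure μ] :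
    Continuous (fun f : H => ∫ w, gradIntegrand L f w ∂μ) :=
  continuous_iff_continuousAt.2 fun f =>
    (hasFDerivAt_integral_gradIntegrand hΦ hκ hL f).continuousAt

theorem continuous_gradientVariation
    (hΦ : StronglyMeasurable (feature H : (X × Y) × (X × Y) → H))
    (hκ : ∀ w : (X × Y) × (X × Y), ‖feature H w‖ ≤ κ) (hL : IsAdmissibleLoss L)
    (P Q : ProbabilityMeasure (X × Y)) : Continuous (gradientVariation (H := H) L P Q) :=
  have hc := fun R₁ R₂ : ProbabilityMeasure (X × Y) => continuous_integral_gradIntegrand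
    (H := H) hΦ hκ hL ((R₁ : Measure (X × Y)).prod (R₂ : Measure (X × Y)))
  (((hc P P).const_smul _).add (hc P Q)).add (hc Q P)

theorem continuous_gradientSecondVariation
    (hΦ : StronglyMeasurable (feature H : (X × Y) × (X × Y) → H))
    (hκ : ∀ w : (X × Y) × (X × Y), ‖feature H w‖ ≤ κ) (hL : IsAdmissibleLoss L)
    (P Q : ProbabilityMeasure (X × Y)) : Continuous (gradientSecondVariation (H := H) L P Q) :=
  have hc := fun R₁ R₂ : ProbabilityMeasure (X × Y) => continuous_integral_gradIntegrand
    (H := H) hΦ hκ hL ((R₁ : Measure (X × Y)).prod (R₂ : Measure (X × Y)))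
  (((hc P P).sub (hc P Q)).sub (hc Q P)).add (hc Q Q)

theorem tendsto_unitInterval_coe_zero :
    Tendsto (fun ε : unitInterval => (ε : ℝ)) (𝓝[≠] 0) (𝓝 0) :=
  (continuous_subtype_val.tendsto (0 : unitInterval)).mono_left nhdsWithin_le_nhds

theorem eventually_unitInterval_coe_ne_zero :
    ∀ᶠ ε : unitInterval in 𝓝[≠] 0, (ε : ℝ) ≠ 0 :=
  eventually_mem_nhdsWithin.mono fun _ hε h => hε (Subtype.ext h)

theorem tendsto_inv_smul_riskGradient_mixture_sub
    (hΦ : StronglyMeasurable (feature H : (X × Y) × (X × Y) → H))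
    (hκ : ∀ w : (X × Y) × (X × Y), ‖feature H w‖ ≤ κ) (hL : IsAdmissibleLoss L)
    (P Q : ProbabilityMeasure (X × Y)) (f : H) :
    Tendsto (fun ε : unitInterval => (ε : ℝ)⁻¹ •
      (riskGradient L lam
          ((mixture P Q ε : Measure (X × Y)).prod (mixture P Q ε : Measure (X × Y))) f
        - riskGradient L lam ((P : Measure (X × Y)).prod (P : Measure (X × Y))) f))
      (𝓝[≠] 0) (𝓝 (gradientVariation L P Q f)) := by
  have h : Tendsto (fun ε : unitInterval => gradientVariation L P Q f
      + (ε : ℝ) • gradientSecondVariation L P Q f) (𝓝[≠] 0) (𝓝 (gradientVariation L P Q f)) := by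
    simpa using tendsto_const_nhds.add
      (tendsto_unitInterval_coe_zero.smul_const (gradientSecondVariation L P Q f))
  refine h.congr' ?_
  filter_upwards [eventually_unitInterval_coe_ne_zero] with ε hε
  rw [riskGradient_mixture hΦ hκ hL, add_assoc, add_sub_cancel_left, smul_add, smul_smul,
    smul_smul, inv_mul_cancel₀ hε, one_smul, pow_two, inv_mul_cancel_left₀ hε]

/-- The minimizer moves by `O(ε)`, by strong monotonicity of the gradient of the perturbed
regularized risk. -/
theorem rplOperator_mixture_sub_isBigO (hlam : 0 < lam)
    (hΦ : StronglyMeasurable (feature H : (X × Y) × (X × Y) → H))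
    (hκ : ∀ w : (X × Y) × (X × Y), ‖feature H w‖ ≤ κ) (hL : IsAdmissibleLoss L)
    (P Q : ProbabilityMeasure (X × Y)) :
    (fun ε : unitInterval => rplOperator H L lam (mixture P Q ε) - rplOperator H L lam P)
      =O[𝓝[≠] 0] (fun ε : unitInterval => (ε : ℝ)) := by
  set f := rplOperator H L lam P
  refine .of_bound ((2 * lam)⁻¹ *
    (‖gradientVariation L P Q f‖ + ‖gradientSecondVariation L P Q f‖)) (.of_forall fun ε => ?_)
  have h0 : (0 : ℝ) ≤ ε := ε.2.1
  have h1 : (ε : ℝ) ≤ 1 := ε.2.2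
  have h := norm_sub_le_norm_riskGradient_sub (lam := lam) hΦ hκ hL (mixture P Q ε)
    (rplOperator H L lam (mixture P Q ε)) f
  rw [(isRegRiskMinimizer_rplOperator hlam hΦ hκ hL (mixture P Q ε)).1,
    riskGradient_mixture hΦ hκ hL, (isRegRiskMinimizer_rplOperator hlam hΦ hκ hL P).1, zero_add,
    zero_sub, norm_neg] at h
  have h2 : ‖(ε : ℝ) • gradientVariation L P Q f + (ε : ℝ) ^ 2 • gradientSecondVariation L P Q f‖
      ≤ (‖gradientVariation L P Q f‖ + ‖gradientSecondVariation L P Q f‖) * ε := by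
    refine (norm_add_le _ _).trans ?_
    rw [norm_smul, norm_smul, Real.norm_of_nonneg h0, Real.norm_of_nonneg (sq_nonneg _)]
    have h3 : (ε : ℝ) ^ 2 ≤ ε := by nlinarith
    have h4 := mul_le_mul_of_nonneg_right h3 (norm_nonneg (gradientSecondVariation L P Q f))
    linarith
  rw [Real.norm_of_nonneg h0, mul_assoc, ← div_eq_inv_mul, le_div_iff₀ (by positivity), mul_comm]
  exact h.trans h2

/-- The function on observations whose integral against `Q` is `gradientVariation L P Q f`. -/
noncomputable def gradientInfluence (L : (X × Y) × (X × Y) → ℝ → ℝ)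
    (P : ProbabilityMeasure (X × Y)) (f : H) (z : X × Y) : H :=
  -(2 : ℝ) • (∫ w, gradIntegrand L f w ∂((P : Measure (X × Y)).prod (P : Measure (X × Y))))
    + (∫ z', gradIntegrand L f (z', z) ∂(P : Measure (X × Y)))
    + ∫ z', gradIntegrand L f (z, z') ∂(P : Measure (X × Y))

theorem stronglyMeasurable_gradientInfluence
    (hΦ : StronglyMeasurable (feature H : (X × Y) × (X × Y) → H)) (hL : IsAdmissibleLoss L)
    (P : ProbabilityMeasure (X × Y)) (f : H) : StronglyMeasurable (gradientInfluence L P f) :=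
  have hg := stronglyMeasurable_gradIntegrand hΦ hL f
  (stronglyMeasurable_const.add hg.integral_prod_left').add hg.integral_prod_right'

theorem exists_norm_gradientInfluence_le
    (hκ : ∀ w : (X × Y) × (X × Y), ‖feature H w‖ ≤ κ) (hL : IsAdmissibleLoss L)
    (P : ProbabilityMeasure (X × Y)) (f : H) : ∃ C, ∀ z, ‖gradientInfluence L P f z‖ ≤ C := by
  obtain ⟨C, hC⟩ := exists_norm_gradIntegrand_le (H := H) hκ hL
  refine ⟨‖-(2 : ℝ) • (∫ w, gradIntegrand L f w
    ∂((P : Measure (X × Y)).prod (P : Measure (X × Y))))‖ + C + C, fun z => ?_⟩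
  have h1 : ‖∫ z', gradIntegrand L f (z', z) ∂(P : Measure (X × Y))‖ ≤ C := by
    simpa using norm_integral_le_of_norm_le_const (μ := (P : Measure (X × Y)))
      (.of_forall fun z' => hC f (z', z))
  have h2 : ‖∫ z', gradIntegrand L f (z, z') ∂(P : Measure (X × Y))‖ ≤ C := by
    simpa using norm_integral_le_of_norm_le_const (μ := (P : Measure (X × Y)))
      (.of_forall fun z' => hC f (z, z'))
  exact (norm_add₃_le).trans (by gcongr)

theorem integral_gradientInfluence
    (hΦ : StronglyMeasurable (feature H : (X × Y) × (X × Y) → H))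
    (hκ : ∀ w : (X × Y) × (X × Y), ‖feature H w‖ ≤ κ) (hL : IsAdmissibleLoss L)
    (P Q : ProbabilityMeasure (X × Y)) (f : H) :
    ∫ z, gradientInfluence L P f z ∂(Q : Measure (X × Y)) = gradientVariation L P Q f := by
  have hPQ : Integrable (gradIntegrand L f)
      ((P : Measure (X × Y)).prod (Q : Measure (X × Y))) := integrable_gradIntegrand hΦ hκ hL f
  have hQP : Integrable (gradIntegrand L f)
      ((Q : Measure (X × Y)).prod (P : Measure (X × Y))) := integrable_gradIntegrand hΦ hκ hL f
  have hsum : Integrable (fun z =>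
      -(2 : ℝ) • (∫ w, gradIntegrand L f w ∂((P : Measure (X × Y)).prod (P : Measure (X × Y))))
        + ∫ z', gradIntegrand L f (z', z) ∂(P : Measure (X × Y))) (Q : Measure (X × Y)) :=
    (integrable_const _).add hPQ.integral_prod_right
  simp only [gradientInfluence]
  rw [integral_add hsum hQP.integral_prod_left,
    integral_add (integrable_const _) hPQ.integral_prod_right, integral_const, probReal_univ,
    one_smul, ← integral_prod_symm _ hPQ, ← integral_prod _ hQP]
  rfl

/-- The Gâteaux derivative exists and is `ν ↦ -M(P)⁻¹ ∫ g dν`, where `g` is the bounded function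
with `∫ g dQ = T(Q; P)` for all `Q`. -/
theorem exists_isBoundedGateauxDerivAt_rplOperator (hlam : 0 < lam)
    (hΦ : StronglyMeasurable (feature H : (X × Y) × (X × Y) → H))
    (hκ : ∀ w : (X × Y) × (X × Y), ‖feature H w‖ ≤ κ) (hL : IsAdmissibleLoss L)
    (P : ProbabilityMeasure (X × Y)) (hM : (opM H L lam P).IsInvertible) :
    ∃ A : SignedMeasure (X × Y) →ₗ[ℝ] H,
      IsBoundedGateauxDerivAt (rplOperator H L lam) A P ∧
      ∀ Q : ProbabilityMeasure (X × Y),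
        A ((Q : Measure (X × Y)).toSignedMeasure - (P : Measure (X × Y)).toSignedMeasure)
          = -((opM H L lam P).inverse (opT H L lam Q P)) ∧
        A ((Q : Measure (X × Y)).toSignedMeasure)
          = -((opM H L lam P).inverse (opT H L lam Q P)) := by
  set f := rplOperator H L lam P with hf
  have hg := stronglyMeasurable_gradientInfluence hΦ hL P f
  obtain ⟨C, hC⟩ := exists_norm_gradientInfluence_le hκ hL P f
  set A : SignedMeasure (X × Y) →ₗ[ℝ] H :=
    -(((opM H L lam P).inverse : H →ₗ[ℝ] H) ∘ₗ signedIntegral (gradientInfluence L P f) hg hC)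
    with hA
  have hAQ : ∀ Q : ProbabilityMeasure (X × Y), A ((Q : Measure (X × Y)).toSignedMeasure)
      = -((opM H L lam P).inverse (opT H L lam Q P)) := fun Q => by
    rw [hA, LinearMap.neg_apply, LinearMap.comp_apply, signedIntegral_toSignedMeasure,
      integral_gradientInfluence hΦ hκ hL]
    rfl
  -- the derivative does not see the mass in the direction of `P`, since `T(P; P) = 0`
  have hAP : A ((P : Measure (X × Y)).toSignedMeasure) = 0 := by
    have hT : opT H L lam P P = 0 := by
      rw [opT]
      module
    rw [hAQ, hT, map_zero, neg_zero]
  have hAQP : ∀ Q : ProbabilityMeasure (X × Y),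
      A ((Q : Measure (X × Y)).toSignedMeasure - (P : Measure (X × Y)).toSignedMeasure)
        = -((opM H L lam P).inverse (opT H L lam Q P)) := fun Q => by
    rw [map_sub, hAP, sub_zero, hAQ]
  refine ⟨A, ⟨⟨‖(opM H L lam P).inverse‖ * (C * ‖(ContinuousLinearMap.lsmul ℝ ℝ (E := H)).flip‖),
    fun ν => ?_⟩, fun Q => ?_⟩, fun Q => ⟨hAQP Q, hAQ Q⟩⟩
  · rw [hA, LinearMap.neg_apply, norm_neg, LinearMap.comp_apply, mul_assoc]
    refine ((opM H L lam P).inverse.le_opNorm _).trans ?_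
    gcongr
    exact norm_signedIntegral_le hg hC ν
  · obtain ⟨e, he⟩ := hM
    rw [hAQP, ← he, ContinuousLinearMap.inverse_equiv]
    refine tendsto_inv_smul_of_perturbed_zero tendsto_unitInterval_coe_zero
      eventually_unitInterval_coe_ne_zero e
      (G := riskGradient L lam ((P : Measure (X × Y)).prod (P : Measure (X × Y))))
      (B := gradientVariation L P Q) (C := gradientSecondVariation L P Q) ?_
      (isRegRiskMinimizer_rplOperator hlam hΦ hκ hL P).1
      (continuous_gradientVariation hΦ hκ hL P Q).continuousAt
      (continuous_gradientSecondVariation hΦ hκ hL P Q).continuousAt (fun ε => ?_)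
      (rplOperator_mixture_sub_isBigO hlam hΦ hκ hL P Q)
    · rw [he]
      exact hasFDerivAt_riskGradient hΦ hκ hL f
    · rw [← riskGradient_mixture hΦ hκ hL]
      exact (isRegRiskMinimizer_rplOperator hlam hΦ hκ hL (mixture P Q ε)).1

end Gateaux

end PairwiseLearning

/-! ### Gâteaux differentiability of the learning operator -/

theorem mainTheorem3
    {X : Type*} [MetricSpace X] [CompleteSpace X] [TopologicalSpace.SeparableSpace X]
    [MeasurableSpace X] [BorelSpace X]
    (Y : Set ℝ) (_hY : IsClosed Y)
    (k : X × X → X × X → ℝ)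
    (hk_cont : Continuous (fun p : (X × X) × (X × X) => k p.1 p.2))
    (hk_bdd : BddAbove (Set.range (fun z : X × X => √(k z z))))
    {H : Type*} [NormedAddCommGroup H] [InnerProductSpace ℝ H] [CompleteSpace H]
    [RKHS ℝ H (X × X) ℝ]
    (hkH : ∀ z z' : X × X, RKHS.kernel H z z' 1 = k z z')
    (L : (X × Y) × (X × Y) → ℝ → ℝ) (hL : PairwiseLearning.IsAdmissibleLoss L)
    (lam : ℝ) (hlam : 0 < lam) :
    -- the risks are finite and the operator is well defined
    (∀ (P : ProbabilityMeasure (X × Y)) (f : H),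
      Integrable (fun w => PairwiseLearning.shiftedLoss L w (PairwiseLearning.evalAt f w))
        ((P : Measure (X × Y)).prod (P : Measure (X × Y)))) ∧
    (∀ P : ProbabilityMeasure (X × Y),
      PairwiseLearning.IsRegRiskMinimizer L lam P (PairwiseLearning.rplOperator H L lam P) ∧
      ∀ g : H, PairwiseLearning.IsRegRiskMinimizer L lam P g →
        g = PairwiseLearning.rplOperator H L lam P) ∧
    ∀ P : ProbabilityMeasure (X × Y),
      -- the Bochner integrals in `T` and `M` exist
      (∀ R₁ R₂ : ProbabilityMeasure (X × Y),
        Integrable (PairwiseLearning.gradIntegrand L (PairwiseLearning.rplOperator H L lam P))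
          ((R₁ : Measure (X × Y)).prod (R₂ : Measure (X × Y))) ∧
        Integrable (PairwiseLearning.hessIntegrand L (PairwiseLearning.rplOperator H L lam P))
          ((R₁ : Measure (X × Y)).prod (R₂ : Measure (X × Y)))) ∧
      (PairwiseLearning.opM H L lam P).IsInvertible ∧
      -- the bounded Gâteaux derivative and its formula
      (∃ A : SignedMeasure (X × Y) →ₗ[ℝ] H,
        PairwiseLearning.IsBoundedGateauxDerivAt (PairwiseLearning.rplOperator H L lam) A P ∧
        ∀ Q : ProbabilityMeasure (X × Y),
          A ((Q : Measure (X × Y)).toSignedMeasure - (P : Measure (X × Y)).toSignedMeasure)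
            = -((PairwiseLearning.opM H L lam P).inverse (PairwiseLearning.opT H L lam Q P)) ∧
          A ((Q : Measure (X × Y)).toSignedMeasure)
            = -((PairwiseLearning.opM H L lam P).inverse (PairwiseLearning.opT H L lam Q P))) ∧
      -- `T(Q; P)` as the derivative at `ε = 0` of the gradient of the regularized risk
      ∀ Q : ProbabilityMeasure (X × Y),
        (∀ ε : unitInterval, DifferentiableAt ℝ
          (PairwiseLearning.regRisk L lam (PairwiseLearning.mixture P Q ε))
          (PairwiseLearning.rplOperator H L lam P)) ∧
        Tendsto
          (fun ε : unitInterval => (ε : ℝ)⁻¹ •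
            (∇ (PairwiseLearning.regRisk L lam (PairwiseLearning.mixture P Q ε))
                (PairwiseLearning.rplOperator H L lam P)
              - ∇ (PairwiseLearning.regRisk L lam P) (PairwiseLearning.rplOperator H L lam P)))
          (𝓝[≠] 0) (𝓝 (PairwiseLearning.opT H L lam Q P)) := by
  have : SecondCountableTopology X := UniformSpace.secondCountable_of_separable X
  have hΦ : StronglyMeasurable (PairwiseLearning.feature H : (X × Y) × (X × Y) → H) :=
    (PairwiseLearning.continuous_kerFun_one hk_cont hkH).stronglyMeasurable.comp_measurable
      (f := fun z : X × X => RKHS.kerFun H z (1 : ℝ))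
      (g := fun w : (X × Y) × (X × Y) => (w.1.1, w.2.1)) (by fun_prop)
  obtain ⟨κ, hκ'⟩ := hk_bdd
  have hκ : ∀ w : (X × Y) × (X × Y), ‖PairwiseLearning.feature H w‖ ≤ κ := fun w =>
    (PairwiseLearning.norm_kerFun_one hkH (w.1.1, w.2.1)).trans_le (hκ' ⟨(w.1.1, w.2.1), rfl⟩)
  refine ⟨fun P f => PairwiseLearning.integrable_shiftedLoss hΦ hκ hL f,
    fun P => (PairwiseLearning.isRegRiskMinimizer_rplOperator hlam hΦ hκ hL P).2, fun P => ?_⟩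
  have hM : (PairwiseLearning.opM H L lam P).IsInvertible :=
    PairwiseLearning.isInvertible_of_coercive (by positivity : 0 < 2 * lam)
      (PairwiseLearning.inner_hessian_ge hΦ hκ hL _)
  have hgrad := fun R : ProbabilityMeasure (X × Y) =>
    PairwiseLearning.hasGradientAt_regRisk (lam := lam) hΦ hκ hL R
      (PairwiseLearning.rplOperator H L lam P)
  refine ⟨fun R₁ R₂ => ⟨PairwiseLearning.integrable_gradIntegrand hΦ hκ hL _,
    PairwiseLearning.integrable_hessIntegrand hΦ hκ hL _⟩, hM,
    PairwiseLearning.exists_isBoundedGateauxDerivAt_rplOperator hlam hΦ hκ hL P hM,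
    fun Q => ⟨fun ε => (hgrad _).differentiableAt, ?_⟩⟩
  simp only [fun R => (hgrad R).gradient]
  exact PairwiseLearning.tendsto_inv_smul_riskGradient_mixture_sub hΦ hκ hL P Q _
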